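/- Notation. For a set $R$ of pairs of words over an alphabet $A$, $\langle A\mid R\rangle$ is the monoid presented by the alphabet $A$ and the relations $u=v$, $(u,v)\in R$; the presentation is homogeneous if $|u|=|v|$ for all $(u,v)\in R$, and multihomogeneous if, for all $(u,v)\in R$, every letter occurs equally often in $u$ and in $v$. Elements $p,q$ of a monoid $M$ are $o$-conjugate, $p\sim_o q$, if there are $g,h\in M$ with $pg=gq$ and $hp=qh$. The $o$-conjugacy problem of a finite presentation $\langle A\mid R\rangle$ ($A$ and $R$ finite) asks, given two words over $A$, whether they represent $o$-conjugate elements; it is undecidable if no algorithm solves it on all inputs. For $A=\{a_1,\dots,a_n\}$ let $\phi:A^*\to\{x,y\}^*$ be the homomorphism with $a_i\mapsto x^2y^ixy^{\,n-i+1}$, and for $R\subseteq A^*\times A^*$ let $R\phi=\{(u\phi,v\phi):(u,v)\in R\}$. Theorem. (1) There is a finitely presented multihomogeneous monoid whose $o$-conjugacy problem is undecidable. More precisely, there are a finite alphabet $A=\{a_1,\dots,a_n\}$ and a finite homogeneous set $R$ of relations over $A$ such that the $o$-conjugacy problem of $\langle A\mid R\rangle$ is undecidable, the presentation $\langle x,y\mid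 R\phi\rangle$ is finite and multihomogeneous, and its $o$-conjugacy problem is undecidable. (2) For every $n\ge 0$, $A=\{a_1,\dots,a_n\}$, and every homogeneous presentation $M=\langle A\mid R\rangle$ (with $R$ finite or infinite), the presentation $N=\langle x,y\mid R\phi\rangle$ is multihomogeneous, $\phi$ induces an injective homomorphism $f:M\to N$, and for all $p,q\in M$ one has $f(p)\sim_o f(q)$ in $N$ if and only if $p\sim_o q$ in $M$. -/

import Mathlib

/-- Two elements `p`, `q` of a monoid `M` are `o`-conjugate if there are `g`, `h` in `M` with
`p g = g q` and `h p = q h`.  (For a monoid, adjoining an identity is not needed: `M¹ = M`.) -/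
def OConj {M : Type*} [Monoid M] (p q : M) : Prop :=
  ∃ g h : M, p * g = g * q ∧ h * p = q * h

/-- The monoid presented by the alphabet `α` and the set `R` of defining relations, a relation
being a pair of words over `α`. -/
abbrev PresMonoid {α : Type*} (R : Set (FreeMonoid α × FreeMonoid α)) : Type _ :=
  PresentedMonoid (fun u v : FreeMonoid α => (u, v) ∈ R)

/-- The element of the presented monoid that a word represents. -/
abbrev PresMonoid.word {α : Type*} (R : Set (FreeMonoid α × FreeMonoid α)) :
    FreeMonoid α →* PresMonoid R :=
  PresentedMonoid.mk (fun u v : FreeMonoid α => (u, v) ∈ R)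

/-- A presentation is homogeneous if the two sides of each relation have the same length. -/
def IsHomogeneous {α : Type*} (R : Set (FreeMonoid α × FreeMonoid α)) : Prop :=
  ∀ r ∈ R, (FreeMonoid.toList r.1).length = (FreeMonoid.toList r.2).length

/-- A presentation is multihomogeneous if the two sides of each relation have the same content,
i.e. contain each letter the same number of times. -/
def IsMultihomogeneous {α : Type*} [DecidableEq α]
    (R : Set (FreeMonoid α × FreeMonoid α)) : Prop :=
  ∀ r ∈ R, ∀ a : α, (FreeMonoid.toList r.1).count a = (FreeMonoid.toList r.2).count a

/-- The `o`-conjugacy problem of a presentation is decidable if there is an algorithm that, given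
two words over the alphabet, decides whether they represent `o`-conjugate elements. -/
def OConjDecidable {α : Type*} [Primcodable α]
    (R : Set (FreeMonoid α × FreeMonoid α)) : Prop :=
  ComputablePred (fun w : List α × List α =>
    OConj (PresMonoid.word R (FreeMonoid.ofList w.1)) (PresMonoid.word R (FreeMonoid.ofList w.2)))

/-- The letter `x` of the two-letter alphabet. -/
def letterX : FreeMonoid (Fin 2) := FreeMonoid.of 0

/-- The letter `y` of the two-letter alphabet. -/
def letterY : FreeMonoid (Fin 2) := FreeMonoid.of 1

/-- The homomorphism from words over `{a₁, …, aₙ}` to words over `{x, y}` that sends `aᵢ` to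
`x² yⁱ x yⁿ⁻ⁱ⁺¹`.  The letter `aᵢ` is the element `i - 1` of `Fin n`, so `k : Fin n` is sent to
`x² yᵏ⁺¹ x yⁿ⁻ᵏ`. -/
def encode (n : ℕ) : FreeMonoid (Fin n) →* FreeMonoid (Fin 2) :=
  FreeMonoid.lift (fun k : Fin n =>
    letterX ^ 2 * letterY ^ ((k : ℕ) + 1) * letterX * letterY ^ (n - (k : ℕ)))

/-- The set of relations `(encode u, encode v)` for `(u, v)` in `R`. -/
def encodeRel {n : ℕ} (R : Set (FreeMonoid (Fin n) × FreeMonoid (Fin n))) :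
    Set (FreeMonoid (Fin 2) × FreeMonoid (Fin 2)) :=
  (fun r => (encode n r.1, encode n r.2)) '' R

/-! The undecidability starts from the halting problem. A finite monoid presentation is built whose
generators are operations on a stack of lists of naturals. Its relations hold for these operations
(`act`), and conversely they suffice to replay every halting computation (`code_push`). Hence
"program `c` sends `v` to `w`" is an equation between two words (`StackLetter.word_eq_iff`).

Homogeneity comes from a central letter `b` (the space): a relation `u = v` becomes `u b^|v| = v
b^|u|`. A free letter `m` (the marker) turns equality into conjugacy: `m u b^|v|` and `m v b^|u|`
are o-conjugate exactly when `u = v` held before padding (`PresMonoid.oConj_padded_iff`).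

For two letters, note that `xx` occurs in a codeword only at its start, so codewords cannot straddle
other codewords. Every word over `{x, y}` thus has a unique longest prefix that is a product of
codewords, and its value in `M`, called `lead`, is an invariant of `N` (`lead_eq_of_word_eq`). It
gives injectivity. Applied to `p g = g q`, it either extracts a conjugator from `M` or, by comparing
lengths, forces `p` and `q` to be trivial (`exists_conjugator`). -/

/-! ### A monoid that evaluates programs: the stack action -/

/-- Generators of the evaluation monoid of `Turing.ToPartrec.Code`: operations on a stack of lists
of natural numbers. -/
inductive StackLetter
  | succHead | zeroHead | nil | succSecond | zeroSecond | dup | swap | nilSecond | consHead | drop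
  | clear | pad
  | test (f : Turing.ToPartrec.Code)
  | code (c : Turing.ToPartrec.Code)

namespace StackLetter

open Turing.ToPartrec FreeMonoid

/-- A stack of lists, empty from some depth on; the two topmost lists are listed separately. -/
abbrev Stack : Type := List ℕ × List ℕ × List (List ℕ)

/-- Increment the head of a list, the empty list counting as `[0]`. -/
def incr (v : List ℕ) : List ℕ := (v.headI + 1) :: v.tail

/-- The partial operation on stacks that a letter denotes. -/
def step : StackLetter → Stack → Part Stack
  | succHead, (u, v, st) => Part.some (incr u, v, st)
  | zeroHead, (u, v, st) => Part.some (0 :: u, v, st)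
  | nil, (u, v, st) => Part.some ([], u, v :: st)
  | succSecond, (u, v, st) => Part.some (u, incr v, st)
  | zeroSecond, (u, v, st) => Part.some (u, 0 :: v, st)
  | dup, (u, v, st) => Part.some (u, u, v :: st)
  | swap, (u, v, st) => Part.some (v, u, st)
  | nilSecond, (u, v, st) => Part.some (u, [], v :: st)
  | consHead, (u, v, st) => Part.some (u.headI :: v, st.headI, st.tail)
  | drop, (_, v, st) => Part.some (v, st.headI, st.tail)
  | clear, (_, v, st) => Part.some ([], v, st)
  | pad, (u, v, st) => Part.some (u.headI :: u.tail, v, st)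
  | test f, (u, v, st) =>
      (if u.headI = 0 then Part.some u.tail else f.fix.eval u.tail).map fun w => (w, v, st)
  | code c, (u, v, st) => (c.eval u).map fun w => (w, v, st)

/-- The action of words on partially defined stacks. -/
def act : FreeMonoid StackLetter →* Function.End (Part Stack) :=
  FreeMonoid.lift fun l p => p.bind (step l)

theorem act_of (l : StackLetter) (p : Part Stack) : act (of l) p = p.bind (step l) := rfl

theorem act_mul (u v : FreeMonoid StackLetter) (p : Part Stack) :
    act (u * v) p = act u (act v p) := by
  rw [map_mul]; rfl

theorem act_one (p : Part Stack) : act 1 p = p := rfl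

theorem act_none (u : FreeMonoid StackLetter) : act u Part.none = Part.none := by
  induction u using FreeMonoid.inductionOn' with
  | one => rfl
  | of_mul l u ih => rw [act_mul, ih, act_of, Part.bind_none]

theorem act_eq_of_some {u v : FreeMonoid StackLetter}
    (h : ∀ x, act u (Part.some x) = act v (Part.some x)) : act u = act v := by
  funext p
  induction p using Part.induction_on with
  | hnone => rw [act_none, act_none]
  | hsome x => exact h x

/-- The relations between letters that do not depend on a compound program. -/
def baseRules : List (FreeMonoid StackLetter × FreeMonoid StackLetter) :=
  [(of succSecond * of succHead, of succHead * of succSecond),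
   (of succSecond * of zeroHead, of zeroHead * of succSecond),
   (of zeroSecond * of succHead, of succHead * of zeroSecond),
   (of zeroSecond * of zeroHead, of zeroHead * of zeroSecond),
   (of succSecond * of nil, of nil * of succHead),
   (of zeroSecond * of nil, of nil * of zeroHead),
   (of dup * of succHead, of succHead * (of succSecond * of dup)),
   (of dup * of zeroHead, of zeroHead * (of zeroSecond * of dup)),
   (of dup * of nil, of nil * of nil),
   (of swap * of succHead, of succSecond * of swap),
   (of swap * of zeroHead, of zeroSecond * of swap),
   (of swap * of nil, of nilSecond),
   (of nilSecond * of succHead, of succHead * of nilSecond),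
   (of nilSecond * of zeroHead, of zeroHead * of nilSecond),
   (of nilSecond * of nil, of nil * of nil),
   (of drop * of succHead, of drop),
   (of drop * of zeroHead, of drop),
   (of drop * of nil, 1),
   (of consHead * of succHead, of succHead * of consHead),
   (of consHead * of zeroHead, of zeroHead * of drop),
   (of consHead * of nil, of zeroHead),
   (of clear * of succHead, of clear),
   (of clear * of zeroHead, of clear),
   (of clear * of nil, of nil),
   (of pad * of succHead, of succHead * of pad),
   (of pad * of zeroHead, of zeroHead),
   (of pad * of nil, of zeroHead * of nil),
   (of (code .zero'), of zeroHead),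
   (of (code .succ) * of succHead, of succHead * of (code .succ)),
   (of (code .succ) * of zeroHead, of succHead * (of zeroHead * of clear)),
   (of (code .succ) * of nil, of succHead * (of zeroHead * of nil)),
   (of (code .tail) * of succHead, of (code .tail)),
   (of (code .tail) * of zeroHead, 1),
   (of (code .tail) * of nil, of nil)]

/-- The relations that define the letters of a compound program and of its
subprograms. -/
def codeRules : Code → List (FreeMonoid StackLetter × FreeMonoid StackLetter)
  | .zero' | .succ | .tail => []
  | .cons f g =>
    (of (code (.cons f g)),
      of consHead * (of swap * (of (code g) * (of swap * (of (code f) * of dup))))) ::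
    (codeRules f ++ codeRules g)
  | .comp f g => (of (code (.comp f g)), of (code f) * of (code g)) :: (codeRules f ++ codeRules g)
  | .case f g =>
    (of (code (.case f g)) * of zeroHead, of (code f)) ::
    -- The rule must hold on all stacks. If the list under `succHead` is empty it counts as `[0]`,
    -- and `pad` supplies that zero to `g`.
    (of (code (.case f g)) * of succHead, of (code g) * of pad) ::
    (of (code (.case f g)) * of nil, of (code f) * of nil) :: (codeRules f ++ codeRules g)
  | .fix f =>
    (of (code (.fix f)), of (test f) * of (code f)) ::
    (of (test f) * of zeroHead, 1) ::
    (of (test f) * of succHead, of (code (.fix f)) * of (code .tail)) ::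
    (of (test f) * of nil, of nil) :: codeRules f

/-- Soundness of the rules. They hold on every stack because a missing head counts as `0` and a
missing list as empty. -/
theorem act_eq_of_mem_baseRules {r : FreeMonoid StackLetter × FreeMonoid StackLetter}
    (hr : r ∈ baseRules) : act r.1 = act r.2 := by
  apply act_eq_of_some
  rintro ⟨u, v, st⟩
  simp only [baseRules, List.mem_cons, List.not_mem_nil, or_false] at hr
  rcases hr with rfl | rfl | rfl | rfl | rfl | rfl | rfl | rfl | rfl | rfl | rfl | rfl | rfl | rfl |
    rfl | rfl | rfl | rfl | rfl | rfl | rfl | rfl | rfl | rfl |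
    rfl | rfl | rfl | rfl | rfl | rfl | rfl | rfl | rfl | rfl <;>
  simp [act_mul, act_of, act_one, step, incr]

/-- One turn of the loop. What follows the body `f` is exactly the operation of the letter `test f`.
-/
theorem eval_fix (f : Code) (v : List ℕ) : f.fix.eval v =
    (f.eval v).bind fun w => if w.headI = 0 then Part.some w.tail else f.fix.eval w.tail := by
  ext w
  rw [Code.fix_eval]
  refine PFun.mem_fix_iff.trans ?_
  simp only [Part.mem_map_iff, Part.mem_bind_iff]
  constructor
  · rintro (⟨x, hx, h⟩ | ⟨a, ⟨x, hx, h⟩, ha⟩) <;> refine ⟨x, hx, ?_⟩ <;>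
      split_ifs at h ⊢ <;> simp_all
  · rintro ⟨x, hx, h⟩
    by_cases h0 : x.headI = 0
    · exact Or.inl ⟨x, hx, by simp_all⟩
    · exact Or.inr ⟨x.tail, ⟨x, hx, by simp_all⟩, by simp_all⟩

theorem act_eq_of_mem_codeRules {c : Code} {r : FreeMonoid StackLetter × FreeMonoid StackLetter}
    (hr : r ∈ codeRules c) : act r.1 = act r.2 := by
  induction c with
  | zero' | succ | tail => simp [codeRules] at hr
  | cons f g hf hg =>
    simp only [codeRules, List.mem_cons, List.mem_append] at hr
    rcases hr with rfl | hr | hr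
    · apply act_eq_of_some
      rintro ⟨u, v, st⟩
      simp [act_mul, act_of, step, Part.bind_assoc, ← Part.bind_some_eq_map]
    · exact hf hr
    · exact hg hr
  | comp f g hf hg =>
    simp only [codeRules, List.mem_cons, List.mem_append] at hr
    rcases hr with rfl | hr | hr
    · apply act_eq_of_some
      rintro ⟨u, v, st⟩
      simp only [act_mul, act_of, step, Part.bind_some, ← Part.bind_some_eq_map, Part.bind_assoc]
      exact Part.bind_assoc _ _ _
    · exact hf hr
    · exact hg hr
  | case f g hf hg =>
    simp only [codeRules, List.mem_cons, List.mem_append] at hr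
    rcases hr with rfl | rfl | rfl | hr | hr
    · apply act_eq_of_some
      rintro ⟨u, v, st⟩
      simp [act_mul, act_of, step]
    · apply act_eq_of_some
      rintro ⟨u, v, st⟩
      simp [act_mul, act_of, step, incr]
    · apply act_eq_of_some
      rintro ⟨u, v, st⟩
      simp [act_mul, act_of, step]
    · exact hf hr
    · exact hg hr
  | fix f hf =>
    simp only [codeRules, List.mem_cons] at hr
    rcases hr with rfl | rfl | rfl | rfl | hr
    · apply act_eq_of_some
      rintro ⟨u, v, st⟩
      simp only [act_mul, act_of, step, Part.bind_some, ← Part.bind_some_eq_map, Part.bind_assoc]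
      rw [eval_fix, Part.bind_assoc]
    · apply act_eq_of_some
      rintro ⟨u, v, st⟩
      simp [act_mul, act_of, act_one, step]
    · apply act_eq_of_some
      rintro ⟨u, v, st⟩
      simp only [act_mul, act_of, step, Part.bind_some, incr]
      simp [step]
    · apply act_eq_of_some
      rintro ⟨u, v, st⟩
      simp [act_mul, act_of, step]
    · exact hf hr

/-- The word that pushes a given list on the stack. -/
def push : List ℕ → FreeMonoid StackLetter
  | [] => of nil
  | n :: v => of succHead ^ n * (of zeroHead * push v)

theorem push_zero (v : List ℕ) : push (0 :: v) = of zeroHead * push v := by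
  rw [push, pow_zero, one_mul]

theorem push_succ (n : ℕ) (v : List ℕ) : push ((n + 1) :: v) = of succHead * push (n :: v) := by
  rw [push, push, pow_succ', mul_assoc]

theorem act_push (v : List ℕ) (u w : List ℕ) (st : List (List ℕ)) :
    act (push v) (Part.some (u, w, st)) = Part.some (v, u, w :: st) := by
  induction v with
  | nil => simp [push, act_of, step]
  | cons n v ih =>
    induction n with
    | zero => rw [push_zero, act_mul, ih]; simp [act_of, step]
    | succ n ihn => rw [push_succ, act_mul, ihn]; simp [act_of, step, incr]

/-- Removes one letter of `push v` at a time, which is how the rules rewrite. -/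
theorem push_induction {P : List ℕ → Prop} (nil : P []) (zero : ∀ v, P v → P (0 :: v))
    (succ : ∀ n v, P (n :: v) → P ((n + 1) :: v)) (v : List ℕ) : P v := by
  induction v with
  | nil => exact nil
  | cons n v ih =>
    induction n with
    | zero => exact zero v ih
    | succ n ihn => exact succ n v ihn

/-! ### Replaying computations by the relations -/

section Derivations

variable {M : Type*} [Monoid M] {φ : FreeMonoid StackLetter →* M}

/-- An operation on the second list travels through the word of the top list and emerges where the
second list begins. -/
theorem second_push (h : ∀ r ∈ baseRules, φ r.1 = φ r.2) (v : List ℕ) :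
    φ (of succSecond * push v) = φ (push v * of succHead) ∧
    φ (of zeroSecond * push v) = φ (push v * of zeroHead) := by
  have h1 := h (of succSecond * of succHead, of succHead * of succSecond) (by simp [baseRules])
  have h2 := h (of succSecond * of zeroHead, of zeroHead * of succSecond) (by simp [baseRules])
  have h3 := h (of zeroSecond * of succHead, of succHead * of zeroSecond) (by simp [baseRules])
  have h4 := h (of zeroSecond * of zeroHead, of zeroHead * of zeroSecond) (by simp [baseRules])
  have h5 := h (of succSecond * of nil, of nil * of succHead) (by simp [baseRules])
  have h6 := h (of zeroSecond * of nil, of nil * of zeroHead) (by simp [baseRules])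
  induction v using push_induction with
  | nil => exact ⟨h5, h6⟩
  | zero v ih =>
    rw [push_zero]
    simp only [map_mul] at *
    exact ⟨by rw [← mul_assoc, h2, mul_assoc, ih.1, mul_assoc],
      by rw [← mul_assoc, h4, mul_assoc, ih.2, mul_assoc]⟩
  | succ n v ih =>
    rw [push_succ]
    simp only [map_mul] at *
    exact ⟨by rw [← mul_assoc, h1, mul_assoc, ih.1, mul_assoc],
      by rw [← mul_assoc, h3, mul_assoc, ih.2, mul_assoc]⟩

/-- Each letter that `dup` passes leaves a copy meant for the second list; `second_push` carries it
beyond the first copy. -/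
theorem dup_push (h : ∀ r ∈ baseRules, φ r.1 = φ r.2) (v : List ℕ) :
    φ (of dup * push v) = φ (push v * push v) := by
  have h1 := h (of dup * of succHead, of succHead * (of succSecond * of dup)) (by simp [baseRules])
  have h2 := h (of dup * of zeroHead, of zeroHead * (of zeroSecond * of dup)) (by simp [baseRules])
  have h3 := h (of dup * of nil, of nil * of nil) (by simp [baseRules])
  have hs := second_push h
  induction v using push_induction with
  | nil => exact h3
  | zero v ih =>
    rw [push_zero]
    simp only [map_mul] at *
    rw [← mul_assoc, h2]
    simp only [mul_assoc]
    rw [ih, ← mul_assoc (φ (of zeroSecond)), (hs v).2]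
    simp only [mul_assoc]
  | succ n v ih =>
    rw [push_succ]
    simp only [map_mul] at *
    rw [← mul_assoc, h1]
    simp only [mul_assoc]
    rw [ih, ← mul_assoc (φ (of succSecond)), (hs _).1]
    simp only [mul_assoc]

theorem nilSecond_push (h : ∀ r ∈ baseRules, φ r.1 = φ r.2) (v : List ℕ) :
    φ (of nilSecond * push v) = φ (push v * of nil) := by
  have h1 := h (of nilSecond * of succHead, of succHead * of nilSecond) (by simp [baseRules])
  have h2 := h (of nilSecond * of zeroHead, of zeroHead * of nilSecond) (by simp [baseRules])
  have h3 := h (of nilSecond * of nil, of nil * of nil) (by simp [baseRules])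
  induction v using push_induction with
  | nil => exact h3
  | zero v ih =>
    rw [push_zero]
    simp only [map_mul] at *
    rw [← mul_assoc, h2, mul_assoc, ih, mul_assoc]
  | succ n v ih =>
    rw [push_succ]
    simp only [map_mul] at *
    rw [← mul_assoc, h1, mul_assoc, ih, mul_assoc]

/-- The letters of `push u` become operations on the second list. Its final `nil` becomes
`nilSecond`, which starts the new second list below `push v`. -/
theorem swap_push (h : ∀ r ∈ baseRules, φ r.1 = φ r.2) (u v : List ℕ) :
    φ (of swap * (push u * push v)) = φ (push v * push u) := by
  have h1 := h (of swap * of succHead, of succSecond * of swap) (by simp [baseRules])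
  have h2 := h (of swap * of zeroHead, of zeroSecond * of swap) (by simp [baseRules])
  have h3 := h (of swap * of nil, of nilSecond) (by simp [baseRules])
  have hn := nilSecond_push h v
  have hs := second_push h v
  induction u using push_induction with
  | nil =>
    simp only [map_mul, push] at *
    rw [← mul_assoc, h3, hn]
  | zero u ih =>
    rw [push_zero]
    simp only [map_mul] at *
    rw [mul_assoc, ← mul_assoc, h2, mul_assoc, ih, ← mul_assoc, hs.2, mul_assoc]
  | succ n u ih =>
    rw [push_succ]
    simp only [map_mul] at *
    rw [mul_assoc, ← mul_assoc, h1, mul_assoc, ih, ← mul_assoc, hs.1, mul_assoc]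

theorem drop_push (h : ∀ r ∈ baseRules, φ r.1 = φ r.2) (v : List ℕ) :
    φ (of drop * push v) = 1 := by
  have h1 := h (of drop * of succHead, of drop) (by simp [baseRules])
  have h2 := h (of drop * of zeroHead, of drop) (by simp [baseRules])
  have h3 := h (of drop * of nil, 1) (by simp [baseRules])
  induction v using push_induction with
  | nil => simpa [push] using h3
  | zero v ih =>
    rw [push_zero]
    simp only [map_mul] at *
    rw [← mul_assoc, h2, ih]
  | succ n v ih =>
    rw [push_succ]
    simp only [map_mul] at *
    rw [← mul_assoc, h1, ih]

theorem clear_push (h : ∀ r ∈ baseRules, φ r.1 = φ r.2) (v : List ℕ) :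
    φ (of clear * push v) = φ (push []) := by
  have h1 := h (of clear * of succHead, of clear) (by simp [baseRules])
  have h2 := h (of clear * of zeroHead, of clear) (by simp [baseRules])
  have h3 := h (of clear * of nil, of nil) (by simp [baseRules])
  induction v using push_induction with
  | nil => simpa [push] using h3
  | zero v ih =>
    rw [push_zero]
    simp only [map_mul] at *
    rw [← mul_assoc, h2, ih]
  | succ n v ih =>
    rw [push_succ]
    simp only [map_mul] at *
    rw [← mul_assoc, h1, ih]

theorem consHead_push (h : ∀ r ∈ baseRules, φ r.1 = φ r.2) (u v : List ℕ) :
    φ (of consHead * (push u * push v)) = φ (push (u.headI :: v)) := by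
  have h1 := h (of consHead * of succHead, of succHead * of consHead) (by simp [baseRules])
  have h2 := h (of consHead * of zeroHead, of zeroHead * of drop) (by simp [baseRules])
  have h3 := h (of consHead * of nil, of zeroHead) (by simp [baseRules])
  have hd := drop_push h
  induction u using push_induction with
  | nil =>
    rw [List.headI_nil, show (default : ℕ) = 0 from rfl, push_zero, push]
    simp only [map_mul] at *
    rw [← mul_assoc, h3]
  | zero u ih =>
    rw [List.headI_cons, push_zero, push_zero]
    simp only [map_mul] at *
    rw [mul_assoc, ← mul_assoc, h2, mul_assoc, ← mul_assoc (φ (of drop)), hd, one_mul]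
  | succ n u ih =>
    rw [List.headI_cons, push_succ, push_succ]
    simp only [map_mul, List.headI_cons] at *
    rw [mul_assoc, ← mul_assoc, h1, mul_assoc, ih]

theorem pad_push (h : ∀ r ∈ baseRules, φ r.1 = φ r.2) (v : List ℕ) :
    φ (of pad * push v) = φ (push (v.headI :: v.tail)) := by
  have h1 := h (of pad * of succHead, of succHead * of pad) (by simp [baseRules])
  have h2 := h (of pad * of zeroHead, of zeroHead) (by simp [baseRules])
  have h3 := h (of pad * of nil, of zeroHead * of nil) (by simp [baseRules])
  induction v using push_induction with
  | nil => simpa [push] using h3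
  | zero v ih =>
    rw [List.headI_cons, List.tail_cons, push_zero]
    simp only [map_mul] at *
    rw [← mul_assoc, h2]
  | succ n v ih =>
    rw [List.headI_cons, List.tail_cons, push_succ]
    simp only [map_mul, List.headI_cons, List.tail_cons] at *
    rw [← mul_assoc, h1, mul_assoc, ih]

theorem succ_push (h : ∀ r ∈ baseRules, φ r.1 = φ r.2) (v : List ℕ) :
    φ (of (code .succ) * push v) = φ (push [v.headI.succ]) := by
  have h1 := h (of (code .succ) * of succHead, of succHead * of (code .succ)) (by simp [baseRules])
  have h2 := h (of (code .succ) * of zeroHead, of succHead * (of zeroHead * of clear))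
    (by simp [baseRules])
  have h3 := h (of (code .succ) * of nil, of succHead * (of zeroHead * of nil))
    (by simp [baseRules])
  have hc := clear_push h
  induction v using push_induction with
  | nil => simpa [push] using h3
  | zero v ih =>
    rw [List.headI_cons, push_succ, push_zero, push_zero]
    simp only [map_mul] at *
    rw [← mul_assoc, h2, mul_assoc, mul_assoc, hc]
  | succ n v ih =>
    rw [List.headI_cons, push_succ, push_succ]
    simp only [map_mul, List.headI_cons] at *
    rw [← mul_assoc, h1, mul_assoc, ih]

theorem tail_push (h : ∀ r ∈ baseRules, φ r.1 = φ r.2) (v : List ℕ) :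
    φ (of (code .tail) * push v) = φ (push v.tail) := by
  have h1 := h (of (code .tail) * of succHead, of (code .tail)) (by simp [baseRules])
  have h2 := h (of (code .tail) * of zeroHead, 1) (by simp [baseRules])
  have h3 := h (of (code .tail) * of nil, of nil) (by simp [baseRules])
  induction v using push_induction with
  | nil => simpa [push] using h3
  | zero v ih =>
    rw [List.tail_cons, push_zero]
    simp only [map_mul] at *
    rw [← mul_assoc, h2, map_one, one_mul]
  | succ n v ih =>
    rw [List.tail_cons, push_succ]
    simp only [map_mul, List.tail_cons] at *
    rw [← mul_assoc, h1, ih]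

/-- Completeness, by induction on the program: each subprogram that halts is replaced by its output.
-/
theorem code_push (h : ∀ r ∈ baseRules, φ r.1 = φ r.2) {c : Code}
    (hc : ∀ r ∈ codeRules c, φ r.1 = φ r.2) {v w : List ℕ} (hw : w ∈ c.eval v) :
    φ (of (code c) * push v) = φ (push w) := by
  induction c generalizing v w with
  | zero' =>
    have h1 := h (of (code .zero'), of zeroHead) (by simp [baseRules])
    obtain rfl : w = 0 :: v := by simpa using hw
    rw [push_zero, map_mul, h1, ← map_mul]
  | succ =>
    obtain rfl : w = [v.headI.succ] := by simpa using hw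
    exact succ_push h v
  | tail =>
    obtain rfl : w = v.tail := by simpa using hw
    exact tail_push h v
  | cons f g hf hg =>
    simp only [codeRules, List.mem_cons, List.mem_append] at hc
    have h1 := hc _ (Or.inl rfl)
    obtain ⟨n, hn, ns, hns, rfl⟩ : ∃ n ∈ f.eval v, ∃ ns ∈ g.eval v, w = n.headI :: ns := by
      simpa [Part.bind_eq_bind] using hw
    have e1 := hf (fun r hr => hc r (.inr (.inl hr))) hn
    have e2 := hg (fun r hr => hc r (.inr (.inr hr))) hns
    have e3 := swap_push h n v
    have e4 := swap_push h ns n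
    have e5 := consHead_push h n ns
    have e6 := dup_push h v
    simp only [map_mul] at *
    simp only [h1, mul_assoc]
    -- The top of the stack runs through `v v`, `n v`, `v n`, `ns n`, `n ns`, and finally `n.headI
    -- :: ns`.
    rw [e6, ← mul_assoc (φ (of (code f))), e1, e3, ← mul_assoc (φ (of (code g))), e2, e4, e5]
  | comp f g hf hg =>
    simp only [codeRules, List.mem_cons, List.mem_append] at hc
    have h1 := hc _ (Or.inl rfl)
    obtain ⟨x, hx, hw⟩ := Part.mem_bind_iff.1 hw
    have e1 := hf (fun r hr => hc r (.inr (.inl hr))) hw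
    have e2 := hg (fun r hr => hc r (.inr (.inr hr))) hx
    simp only [map_mul] at *
    rw [h1, mul_assoc, e2, e1]
  | case f g hf hg =>
    simp only [codeRules, List.mem_cons, List.mem_append] at hc
    have h1 := hc _ (Or.inl rfl)
    have h2 := hc _ (Or.inr (Or.inl rfl))
    have h3 := hc _ (Or.inr (Or.inr (Or.inl rfl)))
    have hf' {v w : List ℕ} := @hf (fun r hr => hc r (.inr (.inr (.inr (.inl hr))))) v w
    have hg' {v w : List ℕ} := @hg (fun r hr => hc r (.inr (.inr (.inr (.inr hr))))) v w
    have hp := pad_push h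
    rw [Code.case_eval] at hw
    match v, hw with
    | [], hw =>
      have e := hf' hw
      simp only [push, List.tail_nil, map_mul] at *
      rw [h3, e]
    | 0 :: v, hw =>
      have e := hf' hw
      simp only [push_zero, List.tail_cons, map_mul] at *
      rw [← mul_assoc, h1, e]
    | (n + 1) :: v, hw =>
      have e := hg' hw
      simp only [push_succ, List.tail_cons, map_mul] at *
      rw [← mul_assoc, h2, mul_assoc, hp, ← e]
      rfl
  | fix f hf =>
    simp only [codeRules, List.mem_cons] at hc
    have h1 := hc _ (Or.inl rfl)
    have h2 := hc _ (Or.inr (Or.inl rfl))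
    have h3 := hc _ (Or.inr (Or.inr (Or.inl rfl)))
    have h4 := hc _ (Or.inr (Or.inr (Or.inr (Or.inl rfl))))
    have hf' {v w : List ℕ} := @hf (fun r hr => hc r (.inr (.inr (.inr (.inr hr))))) v w
    have ht := tail_push h
    simp only [map_mul, map_one] at *
    rw [Code.fix_eval] at hw
    -- Induction along the iterations of the loop: the last one exits with `w`, an earlier one
    -- passes on to `v'`.
    refine PFun.fixInduction' hw ?_ ?_
    · intro v hv
      obtain ⟨x, hx, hxw⟩ := (Part.mem_map_iff _).1 hv
      rw [h1, mul_assoc, hf' hx]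
      match x, hxw with
      | [], hxw =>
        obtain rfl : [] = w := by simpa using hxw
        exact h4
      | 0 :: x, hxw =>
        obtain rfl : x = w := by simpa using hxw
        rw [push_zero, map_mul, ← mul_assoc, h2, one_mul]
    · intro v v' _ hv ih
      obtain ⟨x, hx, hxw⟩ := (Part.mem_map_iff _).1 hv
      rw [h1, mul_assoc, hf' hx, ← ih]
      match x, hxw with
      | (n + 1) :: x, hxw =>
        obtain rfl : x = v' := by simpa using hxw
        rw [push_succ, map_mul, ← mul_assoc, h3, mul_assoc, ht, List.tail_cons]

end Derivations

end StackLetter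

/-! ### Conjugacy and passage to a finite alphabet -/

theorem OConj.map {M N : Type*} [Monoid M] [Monoid N] (f : M →* N) {p q : M} (h : OConj p q) :
    OConj (f p) (f q) := by
  obtain ⟨g, k, h1, h2⟩ := h
  exact ⟨f g, f k, by rw [← map_mul, h1, map_mul], by rw [← map_mul, h2, map_mul]⟩

namespace PresMonoid

open FreeMonoid

variable {α β M : Type*} [Monoid M] {R : Set (FreeMonoid α × FreeMonoid α)}

theorem word_eq {r : FreeMonoid α × FreeMonoid α} (hr : r ∈ R) : word R r.1 = word R r.2 :=
  PresentedMonoid.mk_eq_mk_of_rel hr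

/-- A homomorphism on words that respects the relations factors through the presented monoid. -/
theorem exists_hom (φ : FreeMonoid α →* M) (h : ∀ r ∈ R, φ r.1 = φ r.2) :
    ∃ f : PresMonoid R →* M, ∀ u, f (word R u) = φ u := by
  have e : FreeMonoid.lift (fun a => φ (of a)) = φ := FreeMonoid.hom_eq fun _ => rfl
  refine ⟨PresentedMonoid.lift (fun a => φ (of a)) fun u v huv => ?_, fun u => ?_⟩
  · rw [e]
    exact h _ huv
  · exact DFunLike.congr_fun e u

/-- Two homomorphisms agree on words on whose letters they agree. -/
theorem _root_.FreeMonoid.hom_eq_on {φ ψ : FreeMonoid α →* M} {u : FreeMonoid α}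
    (h : ∀ a ∈ u.toList, φ (of a) = ψ (of a)) : φ u = ψ u := by
  induction u using FreeMonoid.inductionOn' with
  | one => rw [map_one, map_one]
  | of_mul a u ih =>
    rw [map_mul, map_mul, h a (by simp), ih fun b hb => h b (by simp [hb])]

/-- A finite set of relations over any alphabet can be replaced by one over a finite alphabet,
without changing the monoid generated by finitely many given letters. -/
theorem exists_fin [Nonempty α] (hR : R.Finite) {S : Set α} (hS : S.Finite) :
    ∃ (n : ℕ) (e : α → Fin n) (R' : Set (FreeMonoid (Fin n) × FreeMonoid (Fin n))),
      R'.Finite ∧ (IsHomogeneous R → IsHomogeneous R') ∧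
      ∃ (E : PresMonoid R →* PresMonoid R') (D : PresMonoid R' →* PresMonoid R),
        (∀ u, E (word R u) = word R' (map e u)) ∧
        ∀ u : FreeMonoid α, (∀ a ∈ u.toList, a ∈ S) → D (E (word R u)) = word R u := by
  -- The arbitrary letter only ensures that `Fin n` is nonempty, as `Function.invFun` requires.
  set T : Set α := insert (Classical.arbitrary α)
    (S ∪ ⋃ r ∈ R, ({a | a ∈ r.1.toList} ∪ {a | a ∈ r.2.toList})) with hT
  have hTfin : T.Finite := by
    refine (hS.union (hR.biUnion fun r _ => ?_)).insert _
    exact (List.finite_toSet _).union (List.finite_toSet _)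
  obtain ⟨n, d, -, hd⟩ := hTfin.fin_param
  have : Nonempty (Fin n) := by
    have : Classical.arbitrary α ∈ Set.range d := hd ▸ Set.mem_insert _ _
    exact ⟨this.choose⟩
  have hde {a : α} (ha : a ∈ T) : d (Function.invFun d a) = a :=
    Function.invFun_eq (by rwa [← hd] at ha)
  have hword {u : FreeMonoid α} (hu : ∀ a ∈ u.toList, a ∈ T) :
      map d (map (Function.invFun d) u) = u := by
    refine FreeMonoid.hom_eq_on (φ := (map d).comp (map (Function.invFun d)))
      (ψ := MonoidHom.id _) fun a ha => ?_
    simp [hde (hu a ha)]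
  have hR1 {r : FreeMonoid α × FreeMonoid α} (hr : r ∈ R) :
      map d (map (Function.invFun d) r.1) = r.1 ∧ map d (map (Function.invFun d) r.2) = r.2 :=
    ⟨hword fun a ha => Or.inr (Or.inr (Set.mem_biUnion hr (Or.inl ha))),
      hword fun a ha => Or.inr (Or.inr (Set.mem_biUnion hr (Or.inr ha)))⟩
  -- The inverse is a section of `d` over `T`. Letters outside `T` get arbitrary images, which is
  -- harmless since they occur neither in `R` nor in `S`.
  refine ⟨n, Function.invFun d,
    (fun r => (map (Function.invFun d) r.1, map (Function.invFun d) r.2)) '' R, hR.image _, ?_, ?_⟩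
  · rintro h _ ⟨r, hr, rfl⟩
    simpa [toList_map] using h r hr
  · obtain ⟨E, hE⟩ := exists_hom (R := R) ((word _).comp (map (Function.invFun d)))
      fun r hr => word_eq (Set.mem_image_of_mem
        (fun r => (map (Function.invFun d) r.1, map (Function.invFun d) r.2)) hr)
    obtain ⟨D, hD⟩ := exists_hom
      (R := (fun r => (map (Function.invFun d) r.1, map (Function.invFun d) r.2)) '' R)
      ((word R).comp (map d)) (by
        rintro _ ⟨r, hr, rfl⟩
        simp only [MonoidHom.comp_apply, (hR1 hr).1, (hR1 hr).2]
        exact word_eq hr)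
    refine ⟨E, D, hE, fun u hu => ?_⟩
    rw [hE, MonoidHom.comp_apply, hD, MonoidHom.comp_apply,
      hword fun a ha => Or.inr (Or.inl (hu a ha))]

/-! ### Homogenisation, and the word problem as a conjugacy problem -/

/-- The space letter of the padded alphabet. -/
abbrev space : FreeMonoid (α ⊕ Bool) := of (Sum.inr true)

/-- The marker letter of the padded alphabet. -/
abbrev marker : FreeMonoid (α ⊕ Bool) := of (Sum.inr false)

/-- The homogeneous set of relations obtained from `R` by adding a central letter, with which the
sides of the relations are padded, and a free letter. -/
def padded (R : Set (FreeMonoid α × FreeMonoid α)) :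
    Set (FreeMonoid (α ⊕ Bool) × FreeMonoid (α ⊕ Bool)) :=
  ((fun r => (map Sum.inl r.1 * space ^ r.2.length, map Sum.inl r.2 * space ^ r.1.length)) '' R) ∪
    Set.range fun x => (space * of x, of x * space)

theorem padded_finite [Finite α] (hR : R.Finite) : (padded R).Finite :=
  (hR.image _).union (Set.finite_range _)

theorem length_pow (u : FreeMonoid α) (k : ℕ) : (u ^ k).length = k * u.length := by
  induction k with
  | zero => simp
  | succ k ih => rw [pow_succ, length_mul, ih]; ring

theorem length_map (f : α → β) (u : FreeMonoid α) : (map f u).length = u.length := by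
  simp [FreeMonoid.length, toList_map]

theorem isHomogeneous_padded (R : Set (FreeMonoid α × FreeMonoid α)) :
    IsHomogeneous (padded R) := by
  rintro _ (⟨r, -, rfl⟩ | ⟨x, rfl⟩)
  · change FreeMonoid.length _ = FreeMonoid.length _
    simp only [length_mul, length_map, length_pow, length_of]
    ring
  · simp [toList_mul]

theorem commute_space (z : PresMonoid (padded R)) : Commute (word (padded R) space) z := by
  obtain ⟨u, rfl⟩ := PresentedMonoid.surjective_mk z
  induction u using FreeMonoid.inductionOn' with
  | one => rw [map_one]; exact Commute.one_right _
  | of_mul x u ih =>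
    rw [map_mul]
    refine Commute.mul_right ?_ ih
    have := word_eq (R := padded R) (Or.inr ⟨x, rfl⟩)
    rw [map_mul, map_mul] at this
    exact this

/-- Equality in `M` gives equality of padded words. -/
theorem exists_padded_eq {u v : FreeMonoid α} (h : word R u = word R v) :
    ∃ k, word (padded R) (map Sum.inl u * space ^ (k + v.length)) =
      word (padded R) (map Sum.inl v * space ^ (k + u.length)) := by
  have hp := fun (k : ℕ) z => ((commute_space (R := R) z).pow_left k).eq
  set b := word (padded R) space with hb
  have key : ∀ u v : FreeMonoid α, ConGen.Rel (fun u v => (u, v) ∈ R) u v →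
      ∃ k, word (padded R) (map Sum.inl u) * b ^ (k + v.length) =
        word (padded R) (map Sum.inl v) * b ^ (k + u.length) := by
    intro u v h
    induction h with
    | of u v huv =>
      refine ⟨0, ?_⟩
      have := word_eq (R := padded R) (Or.inl ⟨_, huv, rfl⟩)
      simpa only [map_mul, map_pow, zero_add] using this
    | refl u => exact ⟨0, rfl⟩
    | symm _ ih =>
      obtain ⟨k, hk⟩ := ih
      exact ⟨k, hk.symm⟩
    | @trans u v w _ _ ih1 ih2 =>
      obtain ⟨k, hk⟩ := ih1
      obtain ⟨l, hl⟩ := ih2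
      -- Both steps are chained through `v b^(k + |u| + l + |w|)`; the padding by `|v|` belongs to
      -- both and stays in the common excess.
      refine ⟨k + l + v.length, ?_⟩
      rw [show k + l + v.length + w.length = (k + v.length) + (l + w.length) by ring, pow_add,
        ← mul_assoc, hk, mul_assoc, ← pow_add,
        show k + u.length + (l + w.length) = (l + w.length) + (k + u.length) by ring, pow_add,
        ← mul_assoc, hl, mul_assoc, ← pow_add]
      congr 2; ring
    | @mul u v u' v' _ _ ih1 ih2 =>
      obtain ⟨k, hk⟩ := ih1
      obtain ⟨l, hl⟩ := ih2
      refine ⟨k + l, ?_⟩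
      simp only [map_mul, length_mul]
      rw [show k + l + (v.length + v'.length) = (k + v.length) + (l + v'.length) by ring,
        show k + l + (u.length + u'.length) = (k + u.length) + (l + u'.length) by ring,
        pow_add _ (k + v.length), pow_add _ (k + u.length),
        Commute.mul_mul_mul_comm (hp _ _).symm, Commute.mul_mul_mul_comm (hp _ _).symm, hk, hl]
  obtain ⟨k, hk⟩ := key u v (PresentedMonoid.mk_eq_mk_iff.1 h)
  exact ⟨k, by simpa only [map_mul, map_pow] using hk⟩

/-- The action of padded words on nonempty lists over `M`: the marker starts a new entry, other
letters multiply the first entry. -/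
def listAct (R : Set (FreeMonoid α × FreeMonoid α)) :
    FreeMonoid (α ⊕ Bool) →* Function.End (PresMonoid R × List (PresMonoid R)) :=
  FreeMonoid.lift fun x =>
    match x with
    | .inl a => fun s => (word R (of a) * s.1, s.2)
    | .inr true => fun s => s
    | .inr false => fun s => (1, s.1 :: s.2)

theorem listAct_mul (u v : FreeMonoid (α ⊕ Bool)) (s : PresMonoid R × List (PresMonoid R)) :
    listAct R (u * v) s = listAct R u (listAct R v s) := by
  rw [map_mul]; rfl

theorem listAct_space (k : ℕ) (s : PresMonoid R × List (PresMonoid R)) :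
    listAct R (space ^ k) s = s := by
  induction k with
  | zero => rfl
  | succ k ih => rw [pow_succ, listAct_mul]; exact ih

theorem listAct_map (u : FreeMonoid α) (s : PresMonoid R × List (PresMonoid R)) :
    listAct R (map Sum.inl u) s = (word R u * s.1, s.2) := by
  induction u using FreeMonoid.inductionOn' with
  | one => exact Prod.ext (one_mul _).symm rfl
  | of_mul a u ih => rw [map_mul, listAct_mul, ih, map_mul, mul_assoc]; rfl

/-- No letter inspects or changes the entries below the first. -/
theorem listAct_append (u : FreeMonoid (α ⊕ Bool)) (m : PresMonoid R) (l t : List (PresMonoid R)) :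
    listAct R u (m, l ++ t) = ((listAct R u (m, l)).1, (listAct R u (m, l)).2 ++ t) := by
  induction u using FreeMonoid.inductionOn' with
  | one => rfl
  | of_mul x u ih =>
    rw [listAct_mul, ih, listAct_mul]
    rcases x with a | _ | _ <;> rfl

theorem listAct_eq {r : FreeMonoid (α ⊕ Bool) × FreeMonoid (α ⊕ Bool)} (hr : r ∈ padded R) :
    listAct R r.1 = listAct R r.2 := by
  funext s
  rcases hr with ⟨r, hr, rfl⟩ | ⟨x, rfl⟩
  · simp only [listAct_mul, listAct_space, listAct_map, word_eq hr]
  · rfl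

/-- The equation says that each entry equals the next, so the first equals the last. -/
theorem _root_.List.eq_of_cons_eq_append_singleton {γ : Type*} {a b : γ} {l : List γ}
    (h : a :: l = l ++ [b]) : a = b := by
  induction l generalizing a with
  | nil => simpa using h
  | cons c l ih =>
    obtain ⟨rfl, h⟩ := List.cons.inj h
    exact ih h

/-- The word problem of `R` reduces to the `o`-conjugacy problem of `padded R`. -/
theorem oConj_padded_iff (u v : FreeMonoid α) :
    OConj (word (padded R) (marker * map Sum.inl u * space ^ v.length))
      (word (padded R) (marker * map Sum.inl v * space ^ u.length)) ↔ word R u = word R v := by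
  constructor
  · rintro ⟨g, -, hg, -⟩
    obtain ⟨g, rfl⟩ := PresentedMonoid.surjective_mk g
    obtain ⟨f, hf⟩ := exists_hom (listAct R) fun r hr => listAct_eq hr
    -- If `g` takes `(1, [])` to `(c, l)`, the two sides give `(1, u c :: l)` and `(c, l ++ [v])`.
    -- So `c = 1` and `u :: l = l ++ [v]`.
    have h := congrArg (fun z => f z (1, [])) hg
    change f (word _ _ * word _ _) _ = f (word _ _ * word _ _) _ at h
    rw [← map_mul, ← map_mul, hf, hf] at h
    simp only [listAct_mul, listAct_space, listAct_map] at h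
    change ((1 : PresMonoid R), _ :: _) = listAct R g (1, [] ++ [word R v * 1]) at h
    rw [listAct_append, mul_one] at h
    obtain ⟨h1, h2⟩ := Prod.mk.inj h
    rw [← h1, mul_one] at h2
    exact List.eq_of_cons_eq_append_singleton h2
  · intro h
    obtain ⟨k, hk⟩ := exists_padded_eq h
    have hp := fun z => ((commute_space (R := R) z).pow_left k).eq
    -- A power of the central letter serves as conjugator in both directions; it supplies the excess
    -- `k`.
    have e : word (padded R) (marker * map Sum.inl u * space ^ v.length) *
        word (padded R) space ^ k =
        word (padded R) space ^ k *
          word (padded R) (marker * map Sum.inl v * space ^ u.length) := by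
      rw [hp, ← map_pow, ← map_mul, ← map_mul, mul_assoc, mul_assoc, ← pow_add, mul_assoc,
        mul_assoc, ← pow_add, map_mul, add_comm, hk, ← map_mul, add_comm]
    exact ⟨_, _, e, by rw [hp, e, hp]⟩

end PresMonoid

/-! ### The code over two letters -/

open FreeMonoid

/-- The codeword of a letter. -/
def codeword (n : ℕ) (k : Fin n) : List (Fin 2) :=
  0 :: 0 :: (List.replicate ((k : ℕ) + 1) 1 ++ 0 :: List.replicate (n - (k : ℕ)) 1)

theorem toList_of_pow {α : Type*} (a : α) (k : ℕ) : toList (of a ^ k) = List.replicate k a := by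
  induction k with
  | zero => rfl
  | succ k ih => rw [pow_succ', toList_mul, ih]; rfl

theorem toList_encode_of {n : ℕ} (k : Fin n) : toList (encode n (of k)) = codeword n k := by
  simp [encode, letterX, letterY, toList_mul, toList_of_pow, codeword, List.replicate_succ]

theorem toList_encode {n : ℕ} (u : FreeMonoid (Fin n)) :
    toList (encode n u) = u.toList.flatMap (codeword n) := by
  induction u using FreeMonoid.inductionOn' with
  | one => rfl
  | of_mul k u ih => rw [map_mul, toList_mul, ih, toList_encode_of]; rfl

/-- All codewords have the same content, so the content of an encoded word depends only on the
length of the original. -/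
theorem isMultihomogeneous_encodeRel {n : ℕ} {R : Set (FreeMonoid (Fin n) × FreeMonoid (Fin n))}
    (h : IsHomogeneous R) : IsMultihomogeneous (encodeRel R) := by
  have key : ∀ (u : FreeMonoid (Fin n)) (a : Fin 2),
      (toList (encode n u)).count a = u.toList.length * if a = 0 then 3 else n + 1 := by
    intro u a
    induction u using FreeMonoid.inductionOn' with
    | one => simp
    | of_mul k u ih =>
      rw [map_mul, toList_mul, List.count_append, ih, toList_encode_of]
      have := k.2
      fin_cases a
      · simp [codeword, List.count_replicate]; ring
      · simp [codeword, add_mul]; omega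
  rintro _ ⟨r, hr, rfl⟩ a
  rw [key, key, h r hr]

theorem length_encode {n : ℕ} (u : FreeMonoid (Fin n)) :
    (encode n u).length = u.length * (n + 4) := by
  induction u using FreeMonoid.inductionOn' with
  | one => simp
  | of_mul k u ih =>
    have h : (encode n (of k)).length = n + 4 := by
      change (toList (encode n (of k))).length = _
      have := k.2
      rw [toList_encode_of]
      simp [codeword]; omega
    rw [map_mul, length_mul, ih, h, length_mul, length_of]
    ring

theorem replicate_append_inj {a b : ℕ} {s t : List (Fin 2)}
    (h : List.replicate a 1 ++ 0 :: s = List.replicate b 1 ++ 0 :: t) : a = b ∧ s = t := by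
  induction a generalizing b with
  | zero => cases b <;> simp_all [List.replicate_succ]
  | succ a ih =>
    cases b with
    | zero => simp [List.replicate_succ] at h
    | succ b =>
      simp only [List.replicate_succ, List.cons_append, List.cons.injEq, true_and] at h
      simpa using ih h

/-- The length of the block of `y` after the initial `xx` identifies the letter. -/
theorem encode_of_mul_inj {n : ℕ} {j k : Fin n} {s t : FreeMonoid (Fin 2)}
    (h : encode n (of j) * s = encode n (of k) * t) : j = k ∧ s = t := by
  have h' : toList (encode n (of j)) ++ toList s = toList (encode n (of k)) ++ toList t :=
    congrArg toList h
  simp only [toList_encode_of, codeword, List.cons_append, List.append_assoc, List.cons.injEq,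
    true_and] at h'
  obtain ⟨h1, -⟩ := replicate_append_inj h'
  obtain rfl : j = k := Fin.ext (by omega)
  exact ⟨rfl, mul_left_cancel h⟩

theorem isChain_replicate_append {a : ℕ} {l : List (Fin 2)} :
    (List.replicate a 1 ++ l).IsChain (fun x y => x ≠ 0 ∨ y ≠ 0) ↔
      l.IsChain (fun x y => x ≠ 0 ∨ y ≠ 0) := by
  induction a with
  | zero => simp
  | succ a ih =>
    rw [List.replicate_succ, List.cons_append, List.isChain_cons, ih]
    simp

/-- In a codeword, `xx` occurs only at the beginning. -/
theorem eq_nil_of_codeword_eq {n : ℕ} {j : Fin n} {s t : List (Fin 2)}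
    (h : codeword n j = s ++ 0 :: 0 :: t) : s = [] := by
  cases s with
  | nil => rfl
  | cons a s =>
    obtain ⟨m, hm⟩ : ∃ m, n - (j : ℕ) = m + 1 := ⟨n - j - 1, by omega⟩
    -- Without its first letter, a codeword has no two adjacent `x`.
    have h1 : (0 :: (List.replicate ((j : ℕ) + 1) 1 ++ 0 :: List.replicate (n - (j : ℕ)) 1) :
        List (Fin 2)).IsChain (fun x y => x ≠ 0 ∨ y ≠ 0) := by
      rw [List.isChain_cons, isChain_replicate_append, List.isChain_cons, hm,
        ← List.append_nil (List.replicate (m + 1) 1), isChain_replicate_append]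
      simp [List.replicate_succ]
    have h2 := (List.isChain_append (l₁ := s)).1 ((List.cons.inj h).2 ▸ h1)
    simp at h2

theorem codeword_ne_append_zero {n : ℕ} {j : Fin n} {s : List (Fin 2)} :
    codeword n j ≠ s ++ [0] := by
  intro h
  obtain ⟨m, hm⟩ : ∃ m, n - (j : ℕ) = m + 1 := ⟨n - j - 1, by omega⟩
  have h' := congrArg List.getLast? h
  simp [codeword, hm, List.replicate_succ', List.getLast?_cons, List.getLast?_append] at h'

/-- A codeword that starts inside a word before a codeword ends there. -/
theorem exists_eq_encode_mul {n : ℕ} {j k : Fin n} {s t x : FreeMonoid (Fin 2)} (hs : s ≠ 1)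
    (h : s * (encode n (of k) * t) = encode n (of j) * x) : ∃ y, s = encode n (of j) * y := by
  have h' : toList s ++ (toList (encode n (of k)) ++ toList t) =
    toList (encode n (of j)) ++ toList x := congrArg toList h
  rcases List.append_eq_append_iff.1 h' with ⟨m, h1, h2⟩ | ⟨m, h1, -⟩
  · rw [toList_encode_of] at h1 h2
    -- Here `m` is the part of codeword `j` beyond `s`, and codeword `k` begins with it. One letter
    -- would be a final `x`, two or more would put `xx` inside codeword `j`.
    match m, h2 with
    | [], _ => exact ⟨1, by
        rw [mul_one]; exact toList.injective (by rw [toList_encode_of, h1, List.append_nil])⟩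
    | [a], h2 =>
      obtain rfl : 0 = a := (List.cons.inj h2).1
      exact absurd h1 codeword_ne_append_zero
    | a :: b :: m, h2 =>
      simp only [codeword, List.cons_append, List.cons.injEq] at h2
      obtain ⟨rfl, rfl, -⟩ := h2
      exact absurd (eq_nil_of_codeword_eq h1) hs
  · exact ⟨ofList m, toList.injective h1⟩

/-- A word that does not begin with a codeword. -/
def NoCodeword (n : ℕ) (w : FreeMonoid (Fin 2)) : Prop :=
  ∀ (k : Fin n) (x : FreeMonoid (Fin 2)), w ≠ encode n (of k) * x

/-- An initial codeword would have to end within `s`, by `exists_eq_encode_mul`. -/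
theorem NoCodeword.mul_encode {n : ℕ} {s : FreeMonoid (Fin 2)} (h : NoCodeword n s) (hs : s ≠ 1)
    {u : FreeMonoid (Fin n)} (hu : u ≠ 1) (t : FreeMonoid (Fin 2)) :
    NoCodeword n (s * (encode n u * t)) := by
  intro j x e
  cases u using FreeMonoid.casesOn with
  | one => exact hu rfl
  | of_mul k u =>
    rw [map_mul, mul_assoc] at e
    obtain ⟨y, hy⟩ := exists_eq_encode_mul hs e
    exact h j y hy

/-- Every word has a longest prefix that is a product of codewords. -/
theorem exists_encode_mul (n : ℕ) (w : FreeMonoid (Fin 2)) :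
    ∃ (a : FreeMonoid (Fin n)) (x : FreeMonoid (Fin 2)), w = encode n a * x ∧ NoCodeword n x := by
  induction hl : w.length using Nat.strong_induction_on generalizing w with
  | _ l ih =>
    by_cases h : NoCodeword n w
    · exact ⟨1, w, by rw [map_one, one_mul], h⟩
    · simp only [NoCodeword, not_forall, not_not] at h
      obtain ⟨k, y, rfl⟩ := h
      have : y.length < l := by
        rw [← hl, length_mul, length_encode, length_of]
        omega
      obtain ⟨a, x, rfl, hx⟩ := ih _ this y rfl
      exact ⟨of k * a, x, by rw [map_mul, mul_assoc], hx⟩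

theorem encode_mul_inj {n : ℕ} {a b : FreeMonoid (Fin n)} {x y : FreeMonoid (Fin 2)}
    (hx : NoCodeword n x) (hy : NoCodeword n y) (h : encode n a * x = encode n b * y) : a = b := by
  induction a using FreeMonoid.inductionOn' generalizing b with
  | one =>
    cases b using FreeMonoid.casesOn with
    | one => rfl
    | of_mul k b =>
      rw [map_one, one_mul, map_mul, mul_assoc] at h
      exact absurd h (hx _ _)
  | of_mul j a ih =>
    cases b using FreeMonoid.casesOn with
    | one =>
      rw [map_one, one_mul, map_mul, mul_assoc] at h
      exact absurd h.symm (hy _ _)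
    | of_mul k b =>
      simp only [map_mul, mul_assoc] at h
      obtain ⟨rfl, h'⟩ := encode_of_mul_inj h
      rw [ih h']

/-! ### The invariant `lead` and the embedding -/

section Lead

variable {n : ℕ} (R : Set (FreeMonoid (Fin n) × FreeMonoid (Fin n)))

/-- The element represented by the longest prefix that is a product of codewords. -/
noncomputable def lead (w : FreeMonoid (Fin 2)) : PresMonoid R :=
  PresMonoid.word R (exists_encode_mul n w).choose

theorem lead_encode_mul {a : FreeMonoid (Fin n)} {x : FreeMonoid (Fin 2)} (hx : NoCodeword n x) :
    lead R (encode n a * x) = PresMonoid.word R a := by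
  obtain ⟨y, h, hy⟩ := (exists_encode_mul n (encode n a * x)).choose_spec
  exact congrArg _ (encode_mul_inj hx hy h).symm

theorem NoCodeword.lead {x : FreeMonoid (Fin 2)} (hx : NoCodeword n x) : lead R x = 1 := by
  simpa using lead_encode_mul R (a := 1) hx

theorem lead_encode_mul' (a : FreeMonoid (Fin n)) (w : FreeMonoid (Fin 2)) :
    lead R (encode n a * w) = PresMonoid.word R a * lead R w := by
  obtain ⟨b, x, rfl, hx⟩ := exists_encode_mul n w
  rw [lead_encode_mul R hx, ← mul_assoc, ← map_mul, lead_encode_mul R hx, map_mul]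

theorem noCodeword_one (n : ℕ) : NoCodeword n 1 := by
  intro k x h
  have := congrArg FreeMonoid.length h
  rw [length_mul, length_encode, length_of, length_one] at this
  omega

theorem lead_encode (a : FreeMonoid (Fin n)) : lead R (encode n a) = PresMonoid.word R a := by
  simpa using lead_encode_mul R (a := a) (noCodeword_one n)

variable {R}

/-- A relation applied right after a product of codewords is a relation of `M`. Applied after a
nonempty remainder, it lies beyond the longest prefix and cannot alter it. -/
theorem lead_eq_of_word_eq (hR : IsHomogeneous R) {u v : FreeMonoid (Fin 2)}
    (h : PresMonoid.word (encodeRel R) u = PresMonoid.word (encodeRel R) v) :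
    lead R u = lead R v := by
  have key : ∀ u v : FreeMonoid (Fin 2), ConGen.Rel (fun u v => (u, v) ∈ encodeRel R) u v →
      -- Arbitrary contexts are needed for the induction to pass through products.
      ∀ s t, lead R (s * (u * t)) = lead R (s * (v * t)) := by
    intro u v h
    induction h with
    | of u v huv =>
      intro s t
      obtain ⟨r, hr, e⟩ := huv
      obtain ⟨rfl, rfl⟩ := Prod.mk.inj e
      obtain ⟨a, s, rfl, hs⟩ := exists_encode_mul n s
      rw [mul_assoc, mul_assoc, lead_encode_mul', lead_encode_mul' R a]
      congr 1
      by_cases h1 : s = 1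
      · rw [h1, one_mul, one_mul, lead_encode_mul', lead_encode_mul', PresMonoid.word_eq hr]
      · have hl : r.1.length = r.2.length := hR r hr
        -- An empty side does not separate `s` from `t`, but by homogeneity both sides are then
        -- empty.
        by_cases h2 : r.1 = 1
        · have h3 : r.2 = 1 := by
            rw [h2, length_one] at hl
            exact length_eq_zero.1 hl.symm
          rw [h2, h3]
        · have h3 : r.2 ≠ 1 := fun h3 => h2 (length_eq_zero.1 (by rw [hl, h3, length_one]))
          rw [(hs.mul_encode h1 h2 t).lead, (hs.mul_encode h1 h3 t).lead]
    | refl u => exact fun _ _ => rfl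
    | symm _ ih => exact fun s t => (ih s t).symm
    | trans _ _ ih1 ih2 => exact fun s t => (ih1 s t).trans (ih2 s t)
    | mul _ _ ih1 ih2 =>
      intro s t
      rw [mul_assoc, ih1, mul_assoc, ← mul_assoc s, ih2, mul_assoc]
  simpa using key u v (PresentedMonoid.mk_eq_mk_iff.1 h) 1 1

theorem IsHomogeneous.length_eq {α : Type*} {R : Set (FreeMonoid α × FreeMonoid α)}
    (hR : IsHomogeneous R) {u v : FreeMonoid α}
    (h : PresMonoid.word R u = PresMonoid.word R v) : u.length = v.length := by
  have key : ∀ u v : FreeMonoid α, ConGen.Rel (fun u v => (u, v) ∈ R) u v →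
      u.length = v.length := by
    intro u v h
    induction h with
    | of u v huv => exact hR _ huv
    | refl u => rfl
    | symm _ ih => exact ih.symm
    | trans _ _ ih1 ih2 => exact ih1.trans ih2
    | mul _ _ ih1 ih2 => rw [length_mul, length_mul, ih1, ih2]
  exact key u v (PresentedMonoid.mk_eq_mk_iff.1 h)

theorem IsHomogeneous.encodeRel (hR : IsHomogeneous R) : IsHomogeneous (encodeRel R) := by
  rintro _ ⟨r, hr, rfl⟩
  change (encode n r.1).length = (encode n r.2).length
  have : r.1.length = r.2.length := hR r hr
  rw [length_encode, length_encode, this]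

/-- A solution of the conjugacy equation among words over `{x, y}` yields one among words over the
original alphabet, or else the elements are trivial. -/
theorem exists_conjugator (hR : IsHomogeneous R) {p q : FreeMonoid (Fin n)} {g : FreeMonoid (Fin 2)}
    (h : PresMonoid.word (_root_.encodeRel R) (encode n p * g) =
      PresMonoid.word (_root_.encodeRel R) (g * encode n q)) :
    ∃ a, PresMonoid.word R (p * a) = PresMonoid.word R (a * q) := by
  have hlen := hR.encodeRel.length_eq h
  have hlead := lead_eq_of_word_eq hR h
  obtain ⟨a, x, rfl, hx⟩ := exists_encode_mul n g
  by_cases h1 : x = 1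
  · refine ⟨a, ?_⟩
    rwa [h1, mul_one, ← map_mul, ← map_mul, lead_encode, lead_encode] at hlead
  · by_cases h2 : q = 1
    · subst h2
      have : p = 1 := by
        rw [← length_eq_zero]
        simp only [length_mul, length_encode, length_one] at hlen
        nlinarith
      exact ⟨1, by rw [this]⟩
    -- The remainder `x` hides `q`, so `lead` reads `p a = a`. Lengths then force `p`, and hence
    -- `q`, to be empty.
    · have h3 := (hx.mul_encode h1 h2 1)
      rw [mul_one] at h3
      rw [lead_encode_mul', lead_encode_mul R hx, mul_assoc, lead_encode_mul R h3,
        ← map_mul] at hlead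
      have h4 := hR.length_eq hlead
      rw [length_mul, Nat.add_eq_right] at h4
      have h5 : q.length = 0 := by
        simp only [length_mul, length_encode, h4] at hlen
        nlinarith
      exact absurd (length_eq_zero.1 h5) h2

theorem exists_embedding (hR : IsHomogeneous R) :
    ∃ f : PresMonoid R →* PresMonoid (encodeRel R),
      (∀ u : FreeMonoid (Fin n),
        f (PresMonoid.word R u) = PresMonoid.word (encodeRel R) (encode n u)) ∧
      Function.Injective f ∧ ∀ p q : PresMonoid R, OConj (f p) (f q) ↔ OConj p q := by
  obtain ⟨f, hf⟩ := PresMonoid.exists_hom (R := R)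
    ((PresMonoid.word (encodeRel R)).comp (encode n)) fun r hr =>
      PresMonoid.word_eq (R := encodeRel R) ⟨r, hr, rfl⟩
  refine ⟨f, hf, ?_, fun p q => ⟨?_, OConj.map f⟩⟩
  · intro p q h
    obtain ⟨u, rfl⟩ := PresentedMonoid.surjective_mk p
    obtain ⟨v, rfl⟩ := PresentedMonoid.surjective_mk q
    rw [hf, hf] at h
    simpa only [lead_encode] using lead_eq_of_word_eq hR h
  · rintro ⟨g, k, h1, h2⟩
    obtain ⟨u, rfl⟩ := PresentedMonoid.surjective_mk p
    obtain ⟨v, rfl⟩ := PresentedMonoid.surjective_mk q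
    obtain ⟨g, rfl⟩ := PresentedMonoid.surjective_mk g
    obtain ⟨k, rfl⟩ := PresentedMonoid.surjective_mk k
    rw [hf, hf, MonoidHom.comp_apply, MonoidHom.comp_apply] at h1 h2
    rw [← map_mul, ← map_mul] at h1 h2
    obtain ⟨a, ha⟩ := exists_conjugator hR h1
    obtain ⟨b, hb⟩ := exists_conjugator hR h2.symm
    rw [map_mul, map_mul] at ha hb
    exact ⟨_, _, ha, hb.symm⟩

end Lead

/-! ### Undecidability -/

theorem PresMonoid.oConjDecidable_of_encodeRel {n : ℕ}
    {R : Set (FreeMonoid (Fin n) × FreeMonoid (Fin n))} (hR : IsHomogeneous R)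
    (h : OConjDecidable (encodeRel R)) : OConjDecidable R := by
  obtain ⟨f, hf, -, hconj⟩ := exists_embedding hR
  have hc : Primrec fun w : List (Fin n) => w.flatMap (codeword n) :=
    Primrec.list_flatMap Primrec.id ((Primrec.dom_finite (codeword n)).comp Primrec.snd).to₂
  refine ComputablePred.computable_of_manyOneReducible
    ⟨fun w => (w.1.flatMap (codeword n), w.2.flatMap (codeword n)), ?_, fun w => ?_⟩ h
  · exact ((hc.comp Primrec.fst).pair (hc.comp Primrec.snd)).to_comp
  · have e (u : List (Fin n)) : ofList (u.flatMap (codeword n)) = encode n (ofList u) :=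
      toList.injective (by rw [toList_encode]; rfl)
    simp only [e, ← hf, hconj]

/-- There is a program for which it is undecidable on which inputs it returns `0`. -/
theorem exists_code_not_computablePred :
    ∃ c : Turing.ToPartrec.Code, ¬ ComputablePred fun m : ℕ => [0] ∈ c.eval [m] := by
  -- The `m`-th program is run on `0` and its output replaced by `0`, so that returning `0` means
  -- halting.
  have hp : Partrec fun m : ℕ =>
      (Nat.Partrec.Code.eval (Denumerable.ofNat Nat.Partrec.Code m) 0).map fun _ => 0 :=
    (Nat.Partrec.Code.eval_part.comp (Computable.ofNat Nat.Partrec.Code) (Computable.const 0)).map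
      (Computable.const 0).to₂
  obtain ⟨c, hc⟩ := Turing.ToPartrec.Code.exists_code (Nat.Partrec'.part_iff₁.2 hp)
  refine ⟨c, fun h => ComputablePred.halting_problem 0
    (ComputablePred.computable_of_manyOneReducible ⟨Encodable.encode, Computable.encode, ?_⟩ h)⟩
  intro d
  have e := hc (Encodable.encode d ::ᵥ List.Vector.nil)
  change c.eval [Encodable.encode d] = _ at e
  rw [e, List.Vector.head_cons, Denumerable.ofNat_encode]
  simp [Part.dom_iff_mem, pure]

/-- The relations for the evaluation of a program. -/
def StackLetter.evalRules (c : Turing.ToPartrec.Code) :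
    Set (FreeMonoid StackLetter × FreeMonoid StackLetter) :=
  {r | r ∈ baseRules ++ codeRules c}

open StackLetter in
theorem StackLetter.word_eq_iff (c : Turing.ToPartrec.Code) (v w : List ℕ) :
    PresMonoid.word (evalRules c) (of (code c) * push v) =
      PresMonoid.word (evalRules c) (push w) ↔ w ∈ c.eval v := by
  constructor
  · intro h
    obtain ⟨f, hf⟩ := PresMonoid.exists_hom (R := evalRules c) act fun r hr =>
      (List.mem_append.1 hr).elim act_eq_of_mem_baseRules act_eq_of_mem_codeRules
    have h' := congrArg (fun z => f z (Part.some ([], [], []))) h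
    simp only [hf, act_mul, act_push] at h'
    have h'' : (w, ([] : List ℕ), [([] : List ℕ)]) ∈
        (c.eval v).map fun w => (w, ([] : List ℕ), [([] : List ℕ)]) := by
      simpa [act_of, step] using Part.eq_some_iff.1 h'
    simpa using h''
  · exact code_push (fun r hr => PresMonoid.word_eq (R := evalRules c) (List.mem_append_left _ hr))
      (fun r hr => PresMonoid.word_eq (R := evalRules c) (List.mem_append_right _ hr))

theorem Computable.replicate {α : Type*} [Primcodable α] (a : α) :
    Computable fun m : ℕ => List.replicate m a :=
  ((Primrec.list_map Primrec.list_range (Primrec.const a).to₂).of_eq fun m => by simp).to_comp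

open StackLetter in
theorem exists_homogeneous_not_oConjDecidable :
    ∃ (n : ℕ) (R : Set (FreeMonoid (Fin n) × FreeMonoid (Fin n))),
      R.Finite ∧ IsHomogeneous R ∧ ¬ OConjDecidable R := by
  obtain ⟨c, hc⟩ := exists_code_not_computablePred
  have : Nonempty StackLetter := ⟨nil⟩
  have hfin : (evalRules c).Finite := List.finite_toSet _
  obtain ⟨n₁, e₁, R₁, hR₁, -, E₁, D₁, hE₁, hD₁⟩ := PresMonoid.exists_fin hfin
    (S := {code c, succHead, zeroHead, nil}) (Set.toFinite _)
  -- The padded alphabet is already finite; this only renames its letters as some `Fin n₂`.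
  obtain ⟨n₂, e₂, R₂, hR₂, hR₂', E₂, D₂, hE₂, hD₂⟩ :=
    PresMonoid.exists_fin (PresMonoid.padded_finite hR₁) Set.finite_univ
  refine ⟨n₂, R₂, hR₂, hR₂' (PresMonoid.isHomogeneous_padded R₁), fun h => hc ?_⟩
  have hiff (m : ℕ) : OConj
      (PresMonoid.word R₂ (map e₂ (PresMonoid.marker *
        map Sum.inl (map e₁ (of (code c) * push [m])) *
        PresMonoid.space ^ (map e₁ (push [0])).length)))
      (PresMonoid.word R₂ (map e₂ (PresMonoid.marker * map Sum.inl (map e₁ (push [0])) *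
        PresMonoid.space ^ (map e₁ (of (code c) * push [m])).length))) ↔ [0] ∈ c.eval [m] := by
    rw [← StackLetter.word_eq_iff, ← hE₂, ← hE₂]
    trans PresMonoid.word R₁ (map e₁ (of (code c) * push [m])) =
      PresMonoid.word R₁ (map e₁ (push [0]))
    · rw [← PresMonoid.oConj_padded_iff]
      refine ⟨fun h => ?_, OConj.map E₂⟩
      have := h.map D₂
      rwa [hD₂ _ fun _ _ => Set.mem_univ _, hD₂ _ fun _ _ => Set.mem_univ _] at this
    · rw [← hE₁, ← hE₁]
      refine ⟨fun h => ?_, fun h => by rw [h]⟩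
      have := congrArg D₁ h
      rwa [hD₁, hD₁] at this
      · simp [push, toList_mul]
      · simp +contextual [push, toList_mul, toList_of_pow, or_imp]
  -- The words of `hiff` spelled out. Each is padded by the length of the other: `2` for `push [0]`
  -- and `m + 3` for `code c * push [m]`.
  have hcomp : Computable fun m : ℕ =>
      ([e₂ (.inr false), e₂ (.inl (e₁ (code c)))] ++
        (List.replicate m (e₂ (.inl (e₁ succHead))) ++
          [e₂ (.inl (e₁ zeroHead)), e₂ (.inl (e₁ nil)), e₂ (.inr true), e₂ (.inr true)]),
      [e₂ (.inr false), e₂ (.inl (e₁ zeroHead)), e₂ (.inl (e₁ nil))] ++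
        List.replicate (m + 3) (e₂ (.inr true))) := by
    refine Computable.pair ?_ ?_
    · exact Computable.list_append.comp (Computable.const _)
        (Computable.list_append.comp (Computable.replicate _) (Computable.const _))
    · exact Computable.list_append.comp (Computable.const _)
        ((Computable.replicate _).comp
          (Primrec.nat_add.comp Primrec.id (Primrec.const 3)).to_comp)
  refine ComputablePred.computable_of_manyOneReducible ⟨_, hcomp, fun m => ?_⟩ h
  refine (hiff m).symm.trans ?_
  have hl : (map e₁ (push [0])).length = 2 := by
    simp [push, length_mul]
  have hl' : (map e₁ (of (code c) * push [m])).length = m + 3 := by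
    simp [push, length_mul, PresMonoid.length_pow]
    ring
  rw [hl, hl']
  refine Iff.of_eq ?_
  congr 2
  · apply toList.injective
    simp [push, toList_mul, toList_of_pow, List.replicate_succ]
  · apply toList.injective
    simp [push, toList_mul, toList_of_pow]

theorem mainTheorem3 :
    (∃ (n : ℕ) (R : Set (FreeMonoid (Fin n) × FreeMonoid (Fin n))),
      R.Finite ∧ IsHomogeneous R ∧ ¬ OConjDecidable R ∧
      (encodeRel R).Finite ∧ IsMultihomogeneous (encodeRel R) ∧
      ¬ OConjDecidable (encodeRel R)) ∧
    (∀ (n : ℕ) (R : Set (FreeMonoid (Fin n) × FreeMonoid (Fin n))), IsHomogeneous R →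
      IsMultihomogeneous (encodeRel R) ∧
      ∃ f : PresMonoid R →* PresMonoid (encodeRel R),
        (∀ u : FreeMonoid (Fin n),
          f (PresMonoid.word R u) = PresMonoid.word (encodeRel R) (encode n u)) ∧
        Function.Injective f ∧
        ∀ p q : PresMonoid R, OConj (f p) (f q) ↔ OConj p q) := by
  obtain ⟨n, R, hfin, hhom, hdec⟩ := exists_homogeneous_not_oConjDecidable
  exact ⟨⟨n, R, hfin, hhom, hdec, hfin.image _, isMultihomogeneous_encodeRel hhom,
    fun h => hdec (PresMonoid.oConjDecidable_of_encodeRel hhom h)⟩,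
    fun n R hR => ⟨isMultihomogeneous_encodeRel hR, exists_embedding hR⟩⟩
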